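/- All subcategories are full and closed under isomorphisms. Let $\mathcal{A}$ be an abelian category and let $\mathcal{P}$ be an additive subcategory of $\mathcal{A}$ (it contains the zero object and is closed under finite direct sums). For a class $\mathcal{Y}$ of objects, a morphism $f\colon A\to A'$ is a *$\mathcal{Y}$-epimorphism* if $\mathcal{A}(Y,f)$ is surjective for all $Y\in\mathcal{Y}$. A *$\mathcal{Y}$-precover* of $A'$ is a $\mathcal{Y}$-epimorphism $Y\to A'$ with $Y\in\mathcal{Y}$, and $\mathcal{Y}$ is *precovering* if every object of $\mathcal{A}$ has a $\mathcal{Y}$-precover. Dually one defines *$\mathcal{Y}$-monomorphisms*, *$\mathcal{Y}$-preenvelopes* and *preenveloping* classes. The stable category $\underline{\mathcal{A}}=\mathcal{A}/\mathcal{P}$ has the same objects as $\mathcal{A}$, and $\underline{\mathcal{A}}(A,B)$ is the quotient of $\mathcal{A}(A,B)$ by the subgroup of the morphisms that factor through an object of $\mathcal{P}$. For a subcategory $\mathcal{X}$ of $\mathcal{A}$, let $\underline{\mathcal{X}}=\mathcal{X}/\mathcal{P}$ be the full subcategory of $\underline{\mathcal{A}}$ whose objects are those of $\mathcal{X}$.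 If $\mathcal{P}$ is precovering, the loop functor $\Omega\colon\underline{\mathcal{A}}\to\underline{\mathcal{A}}$ sends $A$ to the kernel of a chosen $\mathcal{P}$-precover of $A$; if $\mathcal{P}$ is preenveloping, the suspension functor $\Sigma\colon\underline{\mathcal{A}}\to\underline{\mathcal{A}}$ sends $A$ to the cokernel of a chosen $\mathcal{P}$-preenvelope of $A$. On morphisms they are induced by lifting to the precovers, respectively by extending to the preenvelopes. An additive subcategory $\mathcal{X}$ of $\mathcal{A}$ is *weakly $\mathcal{P}$-resolving* if $\mathcal{P}\subseteq\mathcal{X}$, every object of $\mathcal{X}$ has a $\mathcal{P}$-precover, and $\operatorname{Ker} f\in\mathcal{X}$ for every $\mathcal{P}$-epimorphism $f\colon X\to X'$ with $X,X'\in\mathcal{X}$. It is *weakly $\mathcal{P}$-coresolving* if $\mathcal{P}\subseteq\mathcal{X}$, every object of $\mathcal{X}$ has a $\mathcal{P}$-preenvelope, and $\operatorname{Coker} f\in\mathcal{X}$ for every $\mathcal{P}$-monomorphism $f\colon X\to X'$ with $X,X'\in\mathcal{X}$. A subcategory is *reflective* (resp. *coreflective*) if its inclusion functor has a left (resp. right)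 adjoint. **Statement.** Suppose that $\mathcal{P}$ is precovering and preenveloping in $\mathcal{A}$ and that idempotents split in $\underline{\mathcal{A}}$. Then the assignment $\mathcal{X}\mapsto\underline{\mathcal{X}}$ defines: 1. a bijection from the preenveloping weakly $\mathcal{P}$-resolving subcategories $\mathcal{X}$ of $\mathcal{A}$ closed under direct summands to the reflective subcategories $\mathcal{Z}$ of $\underline{\mathcal{A}}$ with $\Omega(\mathcal{Z})\subseteq\mathcal{Z}$; 2. a bijection from the precovering weakly $\mathcal{P}$-coresolving subcategories $\mathcal{X}$ of $\mathcal{A}$ closed under direct summands to the coreflective subcategories $\mathcal{Z}$ of $\underline{\mathcal{A}}$ with $\Sigma(\mathcal{Z})\subseteq\mathcal{Z}$. -/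

import Mathlib

open CategoryTheory CategoryTheory.Limits

universe v u

namespace StableReflective

section Subcategories

variable {A : Type u} [Category.{v} A] [Preadditive A] [HasZeroObject A]
  [HasBinaryBiproducts A]

/-- A full additive subcategory, given by its class of objects: it is closed under isomorphisms,
contains the zero objects and is closed under finite (co)products. -/
class IsAdditiveSubcategory (P : ObjectProperty A) : Prop where
  of_iso : ∀ ⦃M N : A⦄, (M ≅ N) → P M → P N
  zero : ∀ ⦃M : A⦄, IsZero M → P M
  biprod : ∀ ⦃M N : A⦄, P M → P N → P (M ⊞ N)

/-- The class `X` is closed under direct summands. -/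
def ClosedUnderSummands (X : ObjectProperty A) : Prop :=
  ∀ ⦃M N L : A⦄, (L ≅ M ⊞ N) → X L → X M

end Subcategories

section Precovers

variable {A : Type u} [Category.{v} A]

/-- `f` is a `P`-epimorphism: `Hom(Q, f)` is surjective for every `Q` in `P`. -/
def IsRelEpi (P : ObjectProperty A) {M N : A} (f : M ⟶ N) : Prop :=
  ∀ Q : A, P Q → Function.Surjective (fun h : Q ⟶ M => h ≫ f)

/-- `f` is a `P`-monomorphism: `Hom(f, Q)` is surjective for every `Q` in `P`. -/
def IsRelMono (P : ObjectProperty A) {M N : A} (f : M ⟶ N) : Prop :=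
  ∀ Q : A, P Q → Function.Surjective (fun h : N ⟶ Q => f ≫ h)

/-- `f : X ⟶ M` is a `P`-precover of `M`. -/
structure IsPrecover (P : ObjectProperty A) {X M : A} (f : X ⟶ M) : Prop where
  mem : P X
  relEpi : IsRelEpi P f

/-- `f : M ⟶ X` is a `P`-preenvelope of `M`. -/
structure IsPreenvelope (P : ObjectProperty A) {M X : A} (f : M ⟶ X) : Prop where
  mem : P X
  relMono : IsRelMono P f

/-- `M` has a `P`-precover. -/
def HasPrecover (P : ObjectProperty A) (M : A) : Prop :=
  ∃ (X : A) (f : X ⟶ M), IsPrecover P f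

/-- `M` has a `P`-preenvelope. -/
def HasPreenvelope (P : ObjectProperty A) (M : A) : Prop :=
  ∃ (X : A) (f : M ⟶ X), IsPreenvelope P f

/-- `P` is precovering: every object has a `P`-precover. -/
def IsPrecovering (P : ObjectProperty A) : Prop := ∀ M : A, HasPrecover P M

/-- `P` is preenveloping: every object has a `P`-preenvelope. -/
def IsPreenveloping (P : ObjectProperty A) : Prop := ∀ M : A, HasPreenvelope P M

variable {P : ObjectProperty A}

/-- The source `P_M` of a chosen `P`-precover of `M`. -/
noncomputable def precoverObj (hP : IsPrecovering P) (M : A) : A := (hP M).choose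

/-- A chosen `P`-precover `ξ_M : P_M ⟶ M`. -/
noncomputable def precoverMap (hP : IsPrecovering P) (M : A) : precoverObj hP M ⟶ M :=
  (hP M).choose_spec.choose

theorem precoverMap_spec (hP : IsPrecovering P) (M : A) : IsPrecover P (precoverMap hP M) :=
  (hP M).choose_spec.choose_spec

/-- The target `P^M` of a chosen `P`-preenvelope of `M`. -/
noncomputable def preenvelopeObj (hP : IsPreenveloping P) (M : A) : A := (hP M).choose

/-- A chosen `P`-preenvelope `M ⟶ P^M`. -/
noncomputable def preenvelopeMap (hP : IsPreenveloping P) (M : A) : M ⟶ preenvelopeObj hP M :=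
  (hP M).choose_spec.choose

theorem preenvelopeMap_spec (hP : IsPreenveloping P) (M : A) :
    IsPreenvelope P (preenvelopeMap hP M) :=
  (hP M).choose_spec.choose_spec

/-- A chosen lift `P_M ⟶ P_N` of `f : M ⟶ N`. -/
noncomputable def precoverLift (hP : IsPrecovering P) {M N : A} (f : M ⟶ N) :
    precoverObj hP M ⟶ precoverObj hP N :=
  ((precoverMap_spec hP N).relEpi _ (precoverMap_spec hP M).mem (precoverMap hP M ≫ f)).choose

theorem precoverLift_comp (hP : IsPrecovering P) {M N : A} (f : M ⟶ N) :
    precoverLift hP f ≫ precoverMap hP N = precoverMap hP M ≫ f :=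
  ((precoverMap_spec hP N).relEpi _ (precoverMap_spec hP M).mem
    (precoverMap hP M ≫ f)).choose_spec

/-- A chosen extension `P^M ⟶ P^N` of `f : M ⟶ N`. -/
noncomputable def preenvelopeExt (hP : IsPreenveloping P) {M N : A} (f : M ⟶ N) :
    preenvelopeObj hP M ⟶ preenvelopeObj hP N :=
  ((preenvelopeMap_spec hP M).relMono _ (preenvelopeMap_spec hP N).mem
    (f ≫ preenvelopeMap hP N)).choose

theorem comp_preenvelopeExt (hP : IsPreenveloping P) {M N : A} (f : M ⟶ N) :
    preenvelopeMap hP M ≫ preenvelopeExt hP f = f ≫ preenvelopeMap hP N :=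
  ((preenvelopeMap_spec hP M).relMono _ (preenvelopeMap_spec hP N).mem
    (f ≫ preenvelopeMap hP N)).choose_spec

end Precovers

section Resolving

variable {A : Type u} [Category.{v} A] [Abelian A]

/-- The full additive subcategory `X` is weakly `P`-resolving: it contains `P`, every object of `X`
has a `P`-precover, and `X` is closed under kernels of `P`-epimorphisms. -/
structure IsWeaklyResolving (P X : ObjectProperty A) : Prop where
  additive : IsAdditiveSubcategory X
  le : P ≤ X
  precover : ∀ M : A, X M → HasPrecover P M
  kernel_mem : ∀ ⦃M N : A⦄ (f : M ⟶ N), X M → X N → IsRelEpi P f → X (kernel f)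

/-- The full additive subcategory `X` is weakly `P`-coresolving: it contains `P`, every object of
`X` has a `P`-preenvelope, and `X` is closed under cokernels of `P`-monomorphisms. -/
structure IsWeaklyCoresolving (P X : ObjectProperty A) : Prop where
  additive : IsAdditiveSubcategory X
  le : P ≤ X
  preenvelope : ∀ M : A, X M → HasPreenvelope P M
  cokernel_mem : ∀ ⦃M N : A⦄ (f : M ⟶ N), X M → X N → IsRelMono P f → X (cokernel f)

end Resolving

section Stable

variable {A : Type u} [Category.{v} A]

/-- `f` factors through an object of `P`. -/
def FactorsThru (P : ObjectProperty A) {M N : A} (f : M ⟶ N) : Prop :=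
  ∃ (Q : A) (_ : P Q) (a : M ⟶ Q) (b : Q ⟶ N), a ≫ b = f

variable [Preadditive A]

/-- Two parallel morphisms are identified when their difference factors through an object
of `P`. -/
def stableRel (P : ObjectProperty A) : HomRel A :=
  fun _ _ f g => FactorsThru P (f - g)

/-- The stable category `A/P`. Its objects are those of `A`, and its morphisms are those of `A`
modulo the morphisms that factor through an object of `P`. -/
abbrev Stable (P : ObjectProperty A) := CategoryTheory.Quotient (stableRel P)

/-- The projection functor `A ⥤ A/P`. -/
abbrev toStable (P : ObjectProperty A) : A ⥤ Stable P := CategoryTheory.Quotient.functor (stableRel P)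

/-- For an additive subcategory `P` the relation is already a congruence. -/
theorem stableRel_congruence [HasZeroObject A] [HasBinaryBiproducts A] (P : ObjectProperty A)
    [IsAdditiveSubcategory P] : Congruence (stableRel P) where
  comp_left := by
    rintro X Y Z f g g' ⟨Q, hQ, a, b, h⟩
    exact ⟨Q, hQ, f ≫ a, b, by rw [Category.assoc, h, Preadditive.comp_sub]⟩
  comp_right := by
    rintro X Y Z f f' g ⟨Q, hQ, a, b, h⟩
    exact ⟨Q, hQ, a, b ≫ g, by rw [← Category.assoc, h, Preadditive.sub_comp]⟩
  equivalence := by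
    intro X Y
    refine ⟨fun f => ?_, ?_, ?_⟩
    · exact ⟨_, IsAdditiveSubcategory.zero (isZero_zero A), 0, 0, by simp⟩
    · rintro f g ⟨Q, hQ, a, b, h⟩
      exact ⟨Q, hQ, a, -b, by simp [h]⟩
    · rintro f g k ⟨Q, hQ, a, b, h⟩ ⟨Q', hQ', a', b', h'⟩
      refine ⟨Q ⊞ Q', IsAdditiveSubcategory.biprod hQ hQ', biprod.lift a a',
        biprod.desc b b', ?_⟩
      rw [biprod.lift_desc, h, h']
      abel

/-- The morphisms of `A/P` are the classes of morphisms of `A` modulo the subgroup of those that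
factor through an object of `P`. -/
theorem toStable_map_eq_iff [HasZeroObject A] [HasBinaryBiproducts A] (P : ObjectProperty A)
    [IsAdditiveSubcategory P] {M N : A} (f g : M ⟶ N) :
    (toStable P).map f = (toStable P).map g ↔ FactorsThru P (f - g) :=
  haveI := stableRel_congruence P
  CategoryTheory.Quotient.functor_map_eq_iff (stableRel P) f g

/-- The subcategory `X/P` of `A/P`: its objects are the (images of the) objects of `X`. -/
abbrev stableImage (P X : ObjectProperty A) : ObjectProperty (Stable P) :=
  X.strictMap (toStable P)

end Stable

section Loop

variable {A : Type u} [Category.{v} A] [Abelian A] {P : ObjectProperty A}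

/-- Two lifts `φ`, `ψ` of morphisms with the same class induce the same stable morphism on
kernels. -/
theorem kernelMap_stable_eq (hP : IsPrecovering P) {M N : A} {f g : M ⟶ N}
    (φ ψ : precoverObj hP M ⟶ precoverObj hP N)
    (hφ : precoverMap hP M ≫ f = φ ≫ precoverMap hP N)
    (hψ : precoverMap hP M ≫ g = ψ ≫ precoverMap hP N)
    (h : ∃ s : M ⟶ precoverObj hP N, s ≫ precoverMap hP N = f - g) :
    (toStable P).map (kernel.map (precoverMap hP M) (precoverMap hP N) φ f hφ) =
      (toStable P).map (kernel.map (precoverMap hP M) (precoverMap hP N) ψ g hψ) := by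
  obtain ⟨s, hs⟩ := h
  apply CategoryTheory.Quotient.sound
  have h0 : (φ - ψ - precoverMap hP M ≫ s) ≫ precoverMap hP N = 0 := by
    rw [Preadditive.sub_comp, Preadditive.sub_comp, ← hφ, ← hψ, Category.assoc, hs,
      Preadditive.comp_sub, sub_self]
  refine ⟨precoverObj hP M, (precoverMap_spec hP M).mem, kernel.ι (precoverMap hP M),
    kernel.lift _ _ h0, ?_⟩
  rw [← cancel_mono (kernel.ι (precoverMap hP N))]
  simp [kernel.map]

/-- The functor `A ⥤ A/P` sending `M` to the kernel of its chosen `P`-precover. -/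
noncomputable def preLoop (hP : IsPrecovering P) : A ⥤ Stable P where
  obj M := (toStable P).obj (kernel (precoverMap hP M))
  map f := (toStable P).map
    (kernel.map _ _ (precoverLift hP f) f (precoverLift_comp hP f).symm)
  map_id M := by
    rw [← (toStable P).map_id]
    have := kernelMap_stable_eq hP (f := 𝟙 M) (g := 𝟙 M) (precoverLift hP (𝟙 M)) (𝟙 _)
      (precoverLift_comp hP (𝟙 M)).symm (by simp) ⟨0, by simp⟩
    rw [this]
    congr 1
    rw [← cancel_mono (kernel.ι (precoverMap hP M))]
    simp [kernel.map]
  map_comp {M N L} f g := by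
    rw [← (toStable P).map_comp]
    have := kernelMap_stable_eq hP (f := f ≫ g) (g := f ≫ g) (precoverLift hP (f ≫ g))
      (precoverLift hP f ≫ precoverLift hP g) (precoverLift_comp hP (f ≫ g)).symm
      (by rw [Category.assoc, precoverLift_comp, ← Category.assoc, ← Category.assoc,
        precoverLift_comp]) ⟨0, by simp⟩
    rw [this]
    congr 1
    rw [← cancel_mono (kernel.ι (precoverMap hP L))]
    simp [kernel.map]

/-- The loop functor `Ω : A/P ⥤ A/P` of a precovering class `P`. On objects, `Ω M` is the kernel of
a (chosen) `P`-precover of `M`; on morphisms, it is induced by lifting to the precovers. -/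
noncomputable def loop (hP : IsPrecovering P) : Stable P ⥤ Stable P :=
  CategoryTheory.Quotient.lift (stableRel P) (preLoop hP) (by
    rintro M N f g ⟨Q, hQ, a, b, h⟩
    obtain ⟨c, hc⟩ := (precoverMap_spec hP N).relEpi Q hQ b
    dsimp only at hc
    exact kernelMap_stable_eq hP _ _ _ _ ⟨a ≫ c, by rw [Category.assoc, hc, h]⟩)

end Loop

section Suspension

variable {A : Type u} [Category.{v} A] [Abelian A] {P : ObjectProperty A}

/-- Two extensions `φ`, `ψ` of morphisms with the same class induce the same stable morphism on
cokernels. -/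
theorem cokernelMap_stable_eq (hP : IsPreenveloping P) {M N : A} {f g : M ⟶ N}
    (φ ψ : preenvelopeObj hP M ⟶ preenvelopeObj hP N)
    (hφ : preenvelopeMap hP M ≫ φ = f ≫ preenvelopeMap hP N)
    (hψ : preenvelopeMap hP M ≫ ψ = g ≫ preenvelopeMap hP N)
    (h : ∃ s : preenvelopeObj hP M ⟶ N, preenvelopeMap hP M ≫ s = f - g) :
    (toStable P).map (cokernel.map (preenvelopeMap hP M) (preenvelopeMap hP N) f φ hφ) =
      (toStable P).map (cokernel.map (preenvelopeMap hP M) (preenvelopeMap hP N) g ψ hψ) := by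
  obtain ⟨s, hs⟩ := h
  apply CategoryTheory.Quotient.sound
  have h0 : preenvelopeMap hP M ≫ (φ - ψ - s ≫ preenvelopeMap hP N) = 0 := by
    rw [Preadditive.comp_sub, Preadditive.comp_sub, hφ, hψ, ← Category.assoc, hs,
      Preadditive.sub_comp, sub_self]
  refine ⟨preenvelopeObj hP N, (preenvelopeMap_spec hP N).mem, cokernel.desc _ _ h0,
    cokernel.π (preenvelopeMap hP N), ?_⟩
  rw [← cancel_epi (cokernel.π (preenvelopeMap hP M))]
  simp [cokernel.map]

/-- The functor `A ⥤ A/P` sending `M` to the cokernel of its chosen `P`-preenvelope. -/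
noncomputable def preSuspension (hP : IsPreenveloping P) : A ⥤ Stable P where
  obj M := (toStable P).obj (cokernel (preenvelopeMap hP M))
  map f := (toStable P).map
    (cokernel.map _ _ f (preenvelopeExt hP f) (comp_preenvelopeExt hP f))
  map_id M := by
    rw [← (toStable P).map_id]
    have := cokernelMap_stable_eq hP (f := 𝟙 M) (g := 𝟙 M) (preenvelopeExt hP (𝟙 M)) (𝟙 _)
      (comp_preenvelopeExt hP (𝟙 M)) (by simp) ⟨0, by simp⟩
    rw [this]
    congr 1
    rw [← cancel_epi (cokernel.π (preenvelopeMap hP M))]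
    simp [cokernel.map]
  map_comp {M N L} f g := by
    rw [← (toStable P).map_comp]
    have := cokernelMap_stable_eq hP (f := f ≫ g) (g := f ≫ g) (preenvelopeExt hP (f ≫ g))
      (preenvelopeExt hP f ≫ preenvelopeExt hP g) (comp_preenvelopeExt hP (f ≫ g))
      (by rw [← Category.assoc, comp_preenvelopeExt, Category.assoc, Category.assoc,
        comp_preenvelopeExt]) ⟨0, by simp⟩
    rw [this]
    congr 1
    rw [← cancel_epi (cokernel.π (preenvelopeMap hP M))]
    simp [cokernel.map]

/-- The suspension functor `Σ : A/P ⥤ A/P` of a preenveloping class `P`. On objects, `Σ M` is the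
cokernel of a (chosen) `P`-preenvelope of `M`; on morphisms, it is induced by extending to the
preenvelopes. -/
noncomputable def suspension (hP : IsPreenveloping P) : Stable P ⥤ Stable P :=
  CategoryTheory.Quotient.lift (stableRel P) (preSuspension hP) (by
    rintro M N f g ⟨Q, hQ, a, b, h⟩
    obtain ⟨c, hc⟩ := (preenvelopeMap_spec hP M).relMono Q hQ a
    dsimp only at hc
    exact cokernelMap_stable_eq hP _ _ _ _ ⟨c ≫ b, by rw [← Category.assoc, hc, h]⟩)

end Suspension

section Reflective

variable {C : Type u} [Category.{v} C]

/-- A full subcategory, closed under isomorphisms, whose inclusion has a left adjoint. -/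
structure IsReflectiveSubcategory (Z : ObjectProperty C) : Prop where
  closedUnderIso : Z.IsClosedUnderIsomorphisms
  isRightAdjoint : Z.ι.IsRightAdjoint

/-- A full subcategory, closed under isomorphisms, whose inclusion has a right adjoint. -/
structure IsCoreflectiveSubcategory (Z : ObjectProperty C) : Prop where
  closedUnderIso : Z.IsClosedUnderIsomorphisms
  isLeftAdjoint : Z.ι.IsLeftAdjoint

end Reflective

end StableReflective

/-! Since `toStable P` is bijective on objects, `X ↦ stableImage P X` is injective with inverse `Z ↦
Z.inverseImage (toStable P)`. It remains to match the conditions on the two sides. As `toStable P`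
is also full, everything about A/P can be phrased in A modulo morphisms that factor through P:
reflectivity of X/P means that X is closed under stable isomorphism and that each M has an
`IsStableReflection`.

From X to X/P (`IsWeaklyResolving.exists_stableReflection`): an X-preenvelope f : M ⟶ X₀ gives
existence of factorizations but not uniqueness. A weak cokernel d of f, relative to targets in X,
and a weak kernel k of d inside X yield an endomorphism e of X₀ with f ≫ e = f such that e ≫ g is
stably zero whenever f ≫ g is stably zero with target in X. Applied to g = e - 𝟙, this makes e a
stable idempotent. Splitting e removes the part of X₀ that f does not see, and leaves a reflection.

From Z to its preimage X: a reflection unit with a stable left inverse s (f ≫ s = 𝟙) is a stable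
isomorphism, so its source is in X (`IsStableReflection.mem_of_retraction`). Each closure property
follows by constructing such an s. For the kernel of a P-epimorphism onto N the obvious candidate
fails by a morphism that factors through ΩN up to P; as ΩN lies in X, that error extends along the
unit and can be subtracted (`kernel_mem_of_exists_stableReflection`).

The coreflective half is the reflective half in the opposite category. -/

namespace StableReflective

/-! ### Morphisms factoring through P -/

section FactorsThru

variable {A : Type u} [Category.{v} A] {P : ObjectProperty A}

theorem FactorsThru.comp_left {L M N : A} {g : M ⟶ N} (hg : FactorsThru P g) (f : L ⟶ M) :
    FactorsThru P (f ≫ g) := by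
  obtain ⟨Q, hQ, a, b, rfl⟩ := hg
  exact ⟨Q, hQ, f ≫ a, b, Category.assoc _ _ _⟩

theorem FactorsThru.comp_right {L M N : A} {f : L ⟶ M} (hf : FactorsThru P f) (g : M ⟶ N) :
    FactorsThru P (f ≫ g) := by
  obtain ⟨Q, hQ, a, b, rfl⟩ := hf
  exact ⟨Q, hQ, a, b ≫ g, (Category.assoc _ _ _).symm⟩

theorem FactorsThru.of_source {M N : A} (hM : P M) (f : M ⟶ N) : FactorsThru P f :=
  ⟨M, hM, 𝟙 M, f, Category.id_comp f⟩

end FactorsThru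

/-! ### Additive structure of the stable category -/

section StablePreadditive

variable {A : Type u} [Category.{v} A] [Preadditive A] [HasZeroObject A]
  [HasBinaryBiproducts A] (P : ObjectProperty A) [IsAdditiveSubcategory P]

instance : Congruence (stableRel P) := stableRel_congruence P

omit [HasZeroObject A] in
theorem stableRel_add ⦃M N : A⦄ (f₁ f₂ g₁ g₂ : M ⟶ N) (hf : stableRel P f₁ f₂)
    (hg : stableRel P g₁ g₂) : stableRel P (f₁ + g₁) (f₂ + g₂) := by
  obtain ⟨Q, hQ, a, b, h⟩ := hf
  obtain ⟨Q', hQ', a', b', h'⟩ := hg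
  refine ⟨Q ⊞ Q', IsAdditiveSubcategory.biprod hQ hQ', biprod.lift a a', biprod.desc b b', ?_⟩
  rw [biprod.lift_desc, h, h']
  abel

/-- The additive structure on the stable category. -/
instance stablePreadditive : Preadditive (Stable P) :=
  CategoryTheory.Quotient.preadditive (stableRel P) (stableRel_add P)

instance toStable_additive : (toStable P).Additive where
  map_add := rfl

variable {P}

theorem factorsThru_iff_map_eq_zero {M N : A} (f : M ⟶ N) :
    FactorsThru P f ↔ (toStable P).map f = 0 := by
  rw [← (toStable P).map_zero, toStable_map_eq_iff, sub_zero]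

theorem factorsThru_sub_iff {M N : A} (f g : M ⟶ N) :
    FactorsThru P (f - g) ↔ (toStable P).map f = (toStable P).map g :=
  (toStable_map_eq_iff P f g).symm

theorem FactorsThru.add {M N : A} {f g : M ⟶ N} (hf : FactorsThru P f) (hg : FactorsThru P g) :
    FactorsThru P (f + g) := by
  rw [factorsThru_iff_map_eq_zero] at *
  rw [Functor.map_add, hf, hg, add_zero]

theorem FactorsThru.neg {M N : A} {f : M ⟶ N} (hf : FactorsThru P f) : FactorsThru P (-f) := by
  rw [factorsThru_iff_map_eq_zero] at *
  rw [Functor.map_neg, hf, neg_zero]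

end StablePreadditive

/-! ### Stable notions expressed by representatives in A -/

section StableNotions

variable {A : Type u} [Category.{v} A] [Preadditive A]

/-- `f : M ⟶ R` represents the reflection of `M` in the subcategory `X/P` of `A/P`. -/
structure IsStableReflection (P X : ObjectProperty A) {M R : A} (f : M ⟶ R) : Prop where
  mem : X R
  exists_fac : ∀ ⦃N : A⦄, X N → ∀ a : M ⟶ N, ∃ b : R ⟶ N, FactorsThru P (f ≫ b - a)
  unique : ∀ ⦃N : A⦄, X N → ∀ g : R ⟶ N, FactorsThru P (f ≫ g) → FactorsThru P g

/-- `f : R ⟶ M` represents the coreflection of `M` in the subcategory `X/P` of `A/P`. -/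
structure IsStableCoreflection (P X : ObjectProperty A) {M R : A} (f : R ⟶ M) : Prop where
  mem : X R
  exists_fac : ∀ ⦃N : A⦄, X N → ∀ a : N ⟶ M, ∃ b : N ⟶ R, FactorsThru P (b ≫ f - a)
  unique : ∀ ⦃N : A⦄, X N → ∀ g : N ⟶ R, FactorsThru P (g ≫ f) → FactorsThru P g

/-- `X` is closed under isomorphisms of the stable category `A/P`. -/
def ClosedUnderStableIso (P X : ObjectProperty A) : Prop :=
  ∀ ⦃M N : A⦄ (f : M ⟶ N) (g : N ⟶ M), FactorsThru P (f ≫ g - 𝟙 M) →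
    FactorsThru P (g ≫ f - 𝟙 N) → X M → X N

/-- Morphisms of `A` that are idempotent modulo `P` split modulo `P`. -/
def StableIdempotentsSplit (P : ObjectProperty A) : Prop :=
  ∀ ⦃M : A⦄ (e : M ⟶ M), FactorsThru P (e ≫ e - e) → ∃ (N : A) (i : N ⟶ M) (r : M ⟶ N),
    FactorsThru P (i ≫ r - 𝟙 N) ∧ FactorsThru P (r ≫ i - e)

end StableNotions

section Biproducts

variable {A : Type u} [Category.{v} A] [Preadditive A] [HasBinaryBiproducts A]

/-- An object with the projections and injections of a biproduct is isomorphic to it. -/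
noncomputable def isoBiprodOfTotal {L M N : A} (i : M ⟶ L) (j : N ⟶ L) (p : L ⟶ M) (q : L ⟶ N)
    (hip : i ≫ p = 𝟙 M) (hiq : i ≫ q = 0) (hjp : j ≫ p = 0) (hjq : j ≫ q = 𝟙 N)
    (total : p ≫ i + q ≫ j = 𝟙 L) : L ≅ M ⊞ N where
  hom := biprod.lift p q
  inv := biprod.desc i j
  hom_inv_id := by rw [biprod.lift_desc, total]
  inv_hom_id := by
    ext <;> simp [hip, hiq, hjp, hjq]

end Biproducts

/-! ### From weakly resolving subcategories to stable reflections -/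

section Resolving

variable {A : Type u} [Category.{v} A] [Abelian A] {P X : ObjectProperty A}

/-- The error i ≫ r - 𝟙 passes through some Q in P. Adding Q to M absorbs it, so N becomes an honest
retract of M ⊞ Q, and the kernel of the retraction is a complement. -/
theorem mem_of_stable_retract (hX : IsAdditiveSubcategory X) (hPX : P ≤ X)
    (hsum : ClosedUnderSummands X) {M N : A} (i : N ⟶ M) (r : M ⟶ N)
    (h : FactorsThru P (i ≫ r - 𝟙 N)) (hM : X M) : X N := by
  obtain ⟨Q, hQ, a, b, hab⟩ := h
  let s : N ⟶ M ⊞ Q := biprod.lift i (-a)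
  let p : M ⊞ Q ⟶ N := biprod.desc r b
  have hsp : s ≫ p = 𝟙 N := by
    simp only [s, p, biprod.lift_desc, Preadditive.neg_comp, hab]
    abel
  have h0 : (𝟙 (M ⊞ Q) - p ≫ s) ≫ p = 0 := by
    simp [Preadditive.sub_comp, hsp]
  refine hsum (isoBiprodOfTotal s (kernel.ι p) p (kernel.lift p _ h0) hsp ?_ (by simp) ?_ ?_)
    (hX.biprod hM (hPX _ hQ))
  · rw [← cancel_mono (kernel.ι p)]
    simp [Preadditive.comp_sub, reassoc_of% hsp]
  · rw [← cancel_mono (kernel.ι p)]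
    simp [Preadditive.comp_sub]
  · simp

/-- Pushing f out along a P-preenvelope j of M makes it stably zero. A stable nullity of f ≫ g
extends over j, so g factors through c in A itself and not only modulo P. -/
theorem exists_pseudocokernel (henv : IsPreenveloping P) {M N : A} (f : M ⟶ N) :
    ∃ (D : A) (c : N ⟶ D), FactorsThru P (f ≫ c) ∧
      ∀ ⦃L : A⦄ (g : N ⟶ L), FactorsThru P (f ≫ g) → ∃ t, c ≫ t = g := by
  obtain ⟨E, j, hE, hj⟩ := henv M
  refine ⟨cokernel (biprod.lift f j), biprod.inl ≫ cokernel.π _, ?_, fun L g => ?_⟩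
  · refine ⟨E, hE, j, (-biprod.inr) ≫ cokernel.π _, ?_⟩
    have := (congrArg (· ≫ cokernel.π (biprod.lift f j)) (biprod.lift_eq (f := f) (g := j))).symm.trans
      (cokernel.condition (biprod.lift f j))
    rw [Preadditive.add_comp, Category.assoc, Category.assoc] at this
    rw [Preadditive.neg_comp, Preadditive.comp_neg]
    exact (eq_neg_of_add_eq_zero_left this).symm
  · rintro ⟨Q, hQ, a, b, hab⟩
    obtain ⟨a', ha'⟩ := hj Q hQ a
    dsimp only at ha'
    have h0 : biprod.lift f j ≫ biprod.desc g (-(a' ≫ b)) = 0 := by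
      rw [biprod.lift_desc, Preadditive.comp_neg, reassoc_of% ha', hab, add_neg_cancel]
    exact ⟨cokernel.desc _ _ h0, by simp⟩

/-- Adding a P-precover p of N to d produces a P-epimorphism with source in X, so its kernel stays
in X. Again the factorization holds strictly in A. -/
theorem IsWeaklyResolving.exists_pseudokernel (hX : IsWeaklyResolving P X) {M N : A} (d : M ⟶ N)
    (hM : X M) (hN : X N) :
    ∃ (K : A) (k : K ⟶ M), X K ∧ FactorsThru P (k ≫ d) ∧
      ∀ ⦃L : A⦄ (h : L ⟶ M), FactorsThru P (h ≫ d) → ∃ t, t ≫ k = h := by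
  obtain ⟨E, p, hE, hp⟩ := hX.precover N hN
  have hepi : IsRelEpi P (biprod.desc d p) := fun Q hQ a => by
    obtain ⟨b, hb⟩ := hp Q hQ a
    exact ⟨b ≫ biprod.inr, by simpa using hb⟩
  refine ⟨kernel (biprod.desc d p), kernel.ι _ ≫ biprod.fst,
    hX.kernel_mem _ (hX.additive.biprod hM (hX.le _ hE)) hN hepi, ?_, fun L h => ?_⟩
  · refine ⟨E, hE, kernel.ι _ ≫ (-biprod.snd), p, ?_⟩
    have := (congrArg (kernel.ι (biprod.desc d p) ≫ ·) (biprod.desc_eq (f := d) (g := p))).symm.trans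
      (kernel.condition (biprod.desc d p))
    rw [Preadditive.comp_add] at this
    rw [Preadditive.comp_neg, Preadditive.neg_comp, Category.assoc, Category.assoc]
    exact (eq_neg_of_add_eq_zero_left this).symm
  · rintro ⟨Q, hQ, a, b, hab⟩
    obtain ⟨b', hb'⟩ := hp Q hQ b
    dsimp only at hb'
    have h0 : biprod.lift h (-(a ≫ b')) ≫ biprod.desc d p = 0 := by
      rw [biprod.lift_desc, Preadditive.neg_comp, Category.assoc, hb', hab, add_neg_cancel]
    exact ⟨kernel.lift _ _ h0, by simp⟩

theorem IsWeaklyResolving.closedUnderStableIso (hX : IsWeaklyResolving P X)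
    (hsum : ClosedUnderSummands X) : ClosedUnderStableIso P X :=
  fun _ _ f g _ h hM => mem_of_stable_retract hX.additive hX.le hsum g f h hM

variable [IsAdditiveSubcategory P]

/-- If `X` is preenveloping and weakly `P`-resolving, then the weak reflections given by
`X`-preenvelopes can be cut down by an idempotent to reflections in `X/P`. -/
theorem IsWeaklyResolving.exists_stableReflection (henv : IsPreenveloping P)
    (hidem : StableIdempotentsSplit P) (hX : IsWeaklyResolving P X) (hXenv : IsPreenveloping X)
    (hsum : ClosedUnderSummands X) (M : A) :
    ∃ (R : A) (f : M ⟶ R), IsStableReflection P X f := by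
  obtain ⟨X₀, f, hX₀, hf⟩ := hXenv M
  obtain ⟨D, c, hfc, hc⟩ := exists_pseudocokernel henv f
  obtain ⟨X₁, d', hX₁, hd'⟩ := hXenv D
  -- The composite c ≫ d' is a weak cokernel of f with respect to targets in X, and its own target
  -- is in X, as needed to form a weak kernel there.
  have hd : ∀ ⦃N : A⦄ (_ : X N) (g : X₀ ⟶ N), FactorsThru P (f ≫ g) →
      ∃ t, (c ≫ d') ≫ t = g := fun N hN g hg => by
    obtain ⟨t, ht⟩ := hc g hg
    obtain ⟨t', ht'⟩ := hd' N hN t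
    exact ⟨t', by rw [Category.assoc, ← ht]; exact congrArg (c ≫ ·) ht'⟩
  obtain ⟨K, k, hK, hkd, hk⟩ := hX.exists_pseudokernel (c ≫ d') hX₀ hX₁
  obtain ⟨f', hf'⟩ := hk f (by rw [← Category.assoc]; exact hfc.comp_right d')
  obtain ⟨b, hb⟩ := hf K hK f'
  dsimp only at hb
  -- The endomorphism e = b ≫ k fixes f strictly.
  have hfe : f ≫ b ≫ k = f := by rw [reassoc_of% hb, hf']
  have hkill : ∀ ⦃N : A⦄ (_ : X N) (g : X₀ ⟶ N), FactorsThru P (f ≫ g) →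
      FactorsThru P ((b ≫ k) ≫ g) := fun N hN g hg => by
    obtain ⟨t, rfl⟩ := hd hN g hg
    rw [← Category.assoc, Category.assoc b]
    exact (hkd.comp_left b).comp_right t
  have hee : FactorsThru P ((b ≫ k) ≫ (b ≫ k) - b ≫ k) := by
    -- Since f ≫ (e - 𝟙) = 0, the annihilation property of e gives e ≫ (e - 𝟙) = 0 modulo P.
    have := hkill hX₀ (b ≫ k - 𝟙 X₀) (by
      rw [Preadditive.comp_sub, hfe, Category.comp_id, sub_self]
      exact (factorsThru_iff_map_eq_zero _).2 ((toStable P).map_zero _ _))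
    rwa [Preadditive.comp_sub, Category.comp_id] at this
  obtain ⟨N, i, r, hir, hri⟩ := hidem _ hee
  have hN : X N := mem_of_stable_retract hX.additive hX.le hsum i r hir hX₀
  rw [factorsThru_sub_iff] at hir hri
  simp only [Functor.map_comp] at hir hri
  refine ⟨N, f ≫ r, hN, fun L hL a => ?_, fun L hL g hg => ?_⟩
  · obtain ⟨a', rfl⟩ := hf L hL a
    refine ⟨i ≫ a', ?_⟩
    rw [factorsThru_sub_iff]
    conv_rhs => dsimp only; rw [← hfe]
    simp only [Functor.map_comp, Category.assoc, reassoc_of% hri]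
  · have h₁ := hkill hL (r ≫ g) (by rwa [Category.assoc] at hg)
    have h₂ := h₁.comp_left i
    rw [factorsThru_iff_map_eq_zero] at h₂ ⊢
    rw [← h₂]
    simp only [Functor.map_comp, Category.assoc]
    rw [← Category.assoc ((toStable P).map b), ← hri]
    simp only [Category.assoc, reassoc_of% hir]
    rw [(toStable P).map_id, Category.id_comp, Category.id_comp]

end Resolving

/-! ### From stable reflections to weakly resolving subcategories -/

section Reflections

variable {A : Type u} [Category.{v} A] [Abelian A] {P X : ObjectProperty A}
  [IsAdditiveSubcategory P]

omit [IsAdditiveSubcategory P] in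
-- From f ≫ s = 𝟙 one gets f ≫ (s ≫ f - 𝟙) = 0 modulo P, and uniqueness at R forces s ≫ f = 𝟙; hence
-- f is a stable isomorphism.
theorem IsStableReflection.mem_of_retraction (hX : ClosedUnderStableIso P X) {M R : A}
    {f : M ⟶ R} (hf : IsStableReflection P X f) (s : R ⟶ M) (hs : FactorsThru P (f ≫ s - 𝟙 M)) :
    X M := by
  refine hX s f (hf.unique hf.mem _ ?_) hs hf.mem
  have := hs.comp_right f
  rw [Preadditive.sub_comp, Category.id_comp, Category.assoc] at this
  rwa [Preadditive.comp_sub, Category.comp_id]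

section

variable (hX : ClosedUnderStableIso P X)
  (hrefl : ∀ M : A, ∃ (R : A) (f : M ⟶ R), IsStableReflection P X f)
include hX hrefl

omit [IsAdditiveSubcategory P] in
theorem le_of_exists_stableReflection : P ≤ X := by
  intro Q hQ
  obtain ⟨R, f, hf⟩ := hrefl Q
  -- Objects of P are stably zero, so even the zero map is a stable retraction.
  exact hf.mem_of_retraction hX 0 (.of_source hQ _)

theorem biprod_mem_of_exists_stableReflection {M N : A} (hM : X M) (hN : X N) : X (M ⊞ N) := by
  obtain ⟨R, f, hf⟩ := hrefl (M ⊞ N)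
  obtain ⟨s, hs⟩ := hf.exists_fac hM biprod.fst
  obtain ⟨t, ht⟩ := hf.exists_fac hN biprod.snd
  refine hf.mem_of_retraction hX (s ≫ biprod.inl + t ≫ biprod.inr) ?_
  convert (hs.comp_right biprod.inl).add (ht.comp_right biprod.inr) using 1
  rw [← biprod.total]
  simp only [Preadditive.comp_add, Preadditive.sub_comp, Category.assoc]
  abel

omit [IsAdditiveSubcategory P] in
theorem summand_mem_of_exists_stableReflection : ClosedUnderSummands X := by
  intro M N L e hL
  obtain ⟨R, f, hf⟩ := hrefl M
  obtain ⟨j, hj⟩ := hf.exists_fac hL (biprod.inl ≫ e.inv)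
  refine hf.mem_of_retraction hX (j ≫ e.hom ≫ biprod.fst) ?_
  simpa [Preadditive.sub_comp] using hj.comp_right (e.hom ≫ biprod.fst)

theorem isAdditiveSubcategory_of_exists_stableReflection : IsAdditiveSubcategory X where
  of_iso M N e hM := by
    have h0 : ∀ L : A, FactorsThru P (0 : L ⟶ L) := fun L =>
      (factorsThru_iff_map_eq_zero _).2 ((toStable P).map_zero _ _)
    exact hX e.hom e.inv (by simpa using h0 M) (by simpa using h0 N) hM
  zero M hM := le_of_exists_stableReflection hX hrefl _ (IsAdditiveSubcategory.zero hM)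
  biprod _ _ := biprod_mem_of_exists_stableReflection hX hrefl

/-- The reflection extends morphisms only up to P. A P-preenvelope added as a second component
absorbs the error, which makes the extension strict. -/
theorem isPreenveloping_of_exists_stableReflection (henv : IsPreenveloping P) :
    IsPreenveloping X := by
  intro M
  obtain ⟨R, f, hf⟩ := hrefl M
  obtain ⟨E, j, hE, hj⟩ := henv M
  refine ⟨R ⊞ E, biprod.lift f j, biprod_mem_of_exists_stableReflection hX hrefl hf.mem
    (le_of_exists_stableReflection hX hrefl _ hE), fun N hN a => ?_⟩
  obtain ⟨b, Q, hQ, c, d, hcd⟩ := hf.exists_fac hN a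
  obtain ⟨c', hc'⟩ := hj Q hQ c
  dsimp only at hc'
  refine ⟨biprod.desc b (-(c' ≫ d)), ?_⟩
  dsimp only
  rw [biprod.lift_desc, Preadditive.comp_neg, reassoc_of% hc', hcd]
  abel

/-- Closure under kernels of `P`-epimorphisms: the unit at the kernel of `f : M ⟶ N` has a
retraction up to a morphism that factors through the kernel of a `P`-precover of `N`. -/
theorem kernel_mem_of_exists_stableReflection {M N : A} (f : M ⟶ N) (hM : X M) (hN : X N)
    (hf : IsRelEpi P f) {E : A} {p : E ⟶ N} (hp : IsPrecover P p) (hΩ : X (kernel p)) :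
    X (kernel f) := by
  obtain ⟨R, η, hη⟩ := hrefl (kernel f)
  -- Extend the inclusion of the kernel along the unit, and lift it back to the kernel.
  obtain ⟨k', hk'⟩ := hη.exists_fac hM (kernel.ι f)
  obtain ⟨Q, hQ, a, b, hab⟩ : FactorsThru P (k' ≫ f) := hη.unique hN _ (by
    simpa [Preadditive.sub_comp] using hk'.comp_right f)
  -- Because f is a P-epimorphism, k' can be changed by a morphism through Q so that it lands in the
  -- kernel of f.
  obtain ⟨b', hb'⟩ := hf Q hQ b
  dsimp only at hb'
  have h0 : (k' - a ≫ b') ≫ f = 0 := by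
    rw [Preadditive.sub_comp, Category.assoc, hb', hab, sub_self]
  let s : R ⟶ kernel f := kernel.lift f _ h0
  have hs : FactorsThru P ((η ≫ s - 𝟙 _) ≫ kernel.ι f) := by
    convert hk'.add (g := -(η ≫ a ≫ b')) ⟨Q, hQ, η ≫ a, -b', by simp⟩ using 1
    simp only [s, Preadditive.sub_comp, Category.assoc, kernel.lift_ι, Preadditive.comp_sub,
      Category.id_comp]
    abel
  obtain ⟨Q', hQ', t, q, htq⟩ := hs
  -- `kernel.ι f` need not be stably monic, so `hs` does not yet make s a retraction. Comparing
  -- `kernel p` with `kernel f` through l isolates the obstruction as w ≫ ω.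
  obtain ⟨l, hl⟩ := hf E hp.mem p
  obtain ⟨c, hc⟩ := hp.relEpi Q' hQ' (q ≫ f)
  dsimp only at hl hc
  have hw0 : (t ≫ c) ≫ p = 0 := by
    rw [Category.assoc, hc, reassoc_of% htq, kernel.condition, comp_zero]
  have hω0 : (kernel.ι p ≫ l) ≫ f = 0 := by rw [Category.assoc, hl, kernel.condition]
  have hy0 : (q - c ≫ l) ≫ f = 0 := by
    rw [Preadditive.sub_comp, Category.assoc, hl, hc, sub_self]
  let w : kernel f ⟶ kernel p := kernel.lift p _ hw0
  let ω : kernel p ⟶ kernel f := kernel.lift f _ hω0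
  have hω : η ≫ s - 𝟙 _ - w ≫ ω = t ≫ kernel.lift f _ hy0 := by
    rw [← cancel_mono (kernel.ι f), Preadditive.sub_comp, ← htq]
    simp [w, ω, Preadditive.comp_sub]
  -- Here `kernel p` being in X is used: w extends along the unit, so the obstruction can be
  -- subtracted from s.
  obtain ⟨w', hw'⟩ := hη.exists_fac hΩ w
  refine hη.mem_of_retraction hX (s - w' ≫ ω) ?_
  convert FactorsThru.add (⟨Q', hQ', t, _, hω.symm⟩ : FactorsThru P _)
    (hw'.comp_right ω).neg using 1
  simp only [Preadditive.comp_sub, Preadditive.sub_comp, Category.assoc]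
  abel

end

omit [IsAdditiveSubcategory P] in
theorem IsWeaklyResolving.kernel_precover_mem (hX : IsWeaklyResolving P X) {M E : A} (hM : X M)
    {p : E ⟶ M} (hp : IsPrecover P p) : X (kernel p) :=
  hX.kernel_mem p (hX.le _ hp.mem) hM hp.relEpi

/-- The hypothesis `hΩ` asks for a single precover of each object, with no reference to `loop`, so
that the result applies in the opposite category. -/
theorem isWeaklyResolving_of_exists_stableReflection (hpre : IsPrecovering P)
    (hX : ClosedUnderStableIso P X)
    (hrefl : ∀ M : A, ∃ (R : A) (f : M ⟶ R), IsStableReflection P X f)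
    (hΩ : ∀ M : A, X M → ∃ (E : A) (p : E ⟶ M), IsPrecover P p ∧ X (kernel p)) :
    IsWeaklyResolving P X where
  additive := isAdditiveSubcategory_of_exists_stableReflection hX hrefl
  le := le_of_exists_stableReflection hX hrefl
  precover M _ := hpre M
  kernel_mem M N f hM hN hf := by
    obtain ⟨E, p, hp, hp'⟩ := hΩ N hN
    exact kernel_mem_of_exists_stableReflection hX hrefl f hM hN hf hp hp'

end Reflections

/-! ### Duality -/

section Opposite

variable {A : Type u} [Category.{v} A] {P X : ObjectProperty A}

open Opposite

theorem FactorsThru.op {M N : A} {f : M ⟶ N} (h : FactorsThru P f) : FactorsThru P.op f.op := by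
  obtain ⟨Q, hQ, a, b, rfl⟩ := h
  exact ⟨Opposite.op Q, hQ, b.op, a.op, rfl⟩

theorem FactorsThru.unop {M N : Aᵒᵖ} {f : M ⟶ N} (h : FactorsThru P.op f) :
    FactorsThru P f.unop := by
  obtain ⟨Q, hQ, a, b, rfl⟩ := h
  exact ⟨Q.unop, hQ, b.unop, a.unop, rfl⟩

theorem isRelEpi_op_iff {M N : Aᵒᵖ} (f : M ⟶ N) : IsRelEpi P.op f ↔ IsRelMono P f.unop :=
  ⟨fun h Q hQ a => let ⟨b, hb⟩ := h (op Q) hQ a.op; ⟨b.unop, congrArg Quiver.Hom.unop hb⟩,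
    fun h Q hQ a => let ⟨b, hb⟩ := h Q.unop hQ a.unop; ⟨b.op, congrArg Quiver.Hom.op hb⟩⟩

theorem isRelMono_op_iff {M N : Aᵒᵖ} (f : M ⟶ N) : IsRelMono P.op f ↔ IsRelEpi P f.unop :=
  ⟨fun h Q hQ a => let ⟨b, hb⟩ := h (op Q) hQ a.op; ⟨b.unop, congrArg Quiver.Hom.unop hb⟩,
    fun h Q hQ a => let ⟨b, hb⟩ := h Q.unop hQ a.unop; ⟨b.op, congrArg Quiver.Hom.op hb⟩⟩

theorem hasPrecover_op_iff (M : Aᵒᵖ) : HasPrecover P.op M ↔ HasPreenvelope P M.unop :=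
  ⟨fun ⟨E, p, hE, hp⟩ => ⟨E.unop, p.unop, hE, (isRelEpi_op_iff p).1 hp⟩,
    fun ⟨E, p, hE, hp⟩ => ⟨op E, p.op, hE, (isRelEpi_op_iff p.op).2 hp⟩⟩

theorem hasPreenvelope_op_iff (M : Aᵒᵖ) : HasPreenvelope P.op M ↔ HasPrecover P M.unop :=
  ⟨fun ⟨E, p, hE, hp⟩ => ⟨E.unop, p.unop, hE, (isRelMono_op_iff p).1 hp⟩,
    fun ⟨E, p, hE, hp⟩ => ⟨op E, p.op, hE, (isRelMono_op_iff p.op).2 hp⟩⟩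

theorem isPrecovering_op_iff : IsPrecovering P.op ↔ IsPreenveloping P :=
  ⟨fun h M => (hasPrecover_op_iff _).1 (h (op M)), fun h M => (hasPrecover_op_iff _).2 (h M.unop)⟩

theorem isPreenveloping_op_iff : IsPreenveloping P.op ↔ IsPrecovering P :=
  ⟨fun h M => (hasPreenvelope_op_iff _).1 (h (op M)),
    fun h M => (hasPreenvelope_op_iff _).2 (h M.unop)⟩

section

variable [Preadditive A]

theorem closedUnderStableIso_op (h : ClosedUnderStableIso P X) :
    ClosedUnderStableIso P.op X.op := fun _ _ f g hfg hgf hM =>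
  h g.unop f.unop hfg.unop hgf.unop hM

theorem closedUnderStableIso_of_op (h : ClosedUnderStableIso P.op X.op) :
    ClosedUnderStableIso P X := fun _ _ f g hfg hgf hM =>
  h g.op f.op hfg.op hgf.op hM

theorem StableIdempotentsSplit.op (h : StableIdempotentsSplit P) :
    StableIdempotentsSplit P.op := fun _ e he => by
  obtain ⟨N, i, r, hir, hri⟩ := h e.unop he.unop
  exact ⟨Opposite.op N, r.op, i.op, hir.op, hri.op⟩

theorem exists_stableReflection_op_iff (M : Aᵒᵖ) :
    (∃ (R : Aᵒᵖ) (f : M ⟶ R), IsStableReflection P.op X.op f) ↔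
      ∃ (R : A) (f : R ⟶ M.unop), IsStableCoreflection P X f := by
  constructor
  · rintro ⟨R, f, hf⟩
    refine ⟨R.unop, f.unop, hf.mem, fun N hN a => ?_, fun N hN g hg =>
      (hf.unique (N := Opposite.op N) hN g.op hg.op).unop⟩
    obtain ⟨b, hb⟩ := hf.exists_fac (N := Opposite.op N) hN a.op
    exact ⟨b.unop, hb.unop⟩
  · rintro ⟨R, f, hf⟩
    refine ⟨Opposite.op R, f.op, hf.mem, fun N hN a => ?_, fun N hN g hg =>
      (hf.unique (N := N.unop) hN g.unop hg.unop).op⟩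
    obtain ⟨b, hb⟩ := hf.exists_fac (N := N.unop) hN a.unop
    exact ⟨b.op, hb.op⟩

end

section

variable [Abelian A]

/-- The opposite of a biproduct is a biproduct in the opposite category. -/
noncomputable def opBiprodIso (M N : A) : op (M ⊞ N) ≅ op M ⊞ op N :=
  isoBiprodOfTotal biprod.fst.op biprod.snd.op biprod.inl.op biprod.inr.op
    (Quiver.Hom.unop_inj (by simp)) (Quiver.Hom.unop_inj (by simp))
    (Quiver.Hom.unop_inj (by simp)) (Quiver.Hom.unop_inj (by simp))
    (Quiver.Hom.unop_inj biprod.total)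

theorem IsAdditiveSubcategory.op (h : IsAdditiveSubcategory P) : IsAdditiveSubcategory P.op where
  of_iso _ _ e := h.of_iso e.symm.unop
  zero _ hM := h.zero hM.unop
  biprod M N hM hN := h.of_iso (opBiprodIso M.unop N.unop).symm.unop (h.biprod hM hN)

theorem IsAdditiveSubcategory.of_op (h : IsAdditiveSubcategory P.op) :
    IsAdditiveSubcategory P where
  of_iso _ _ e := h.of_iso e.symm.op
  zero _ hM := h.zero hM.op
  biprod M N hM hN := h.of_iso (M := Opposite.op M ⊞ Opposite.op N) (opBiprodIso M N).symm
    (h.biprod hM hN)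

theorem closedUnderSummands_op_iff : ClosedUnderSummands X.op ↔ ClosedUnderSummands X :=
  ⟨fun h M N L e hL => h (M := op M) (N := op N) (L := op L) (e.symm.op ≪≫ opBiprodIso M N) hL,
    fun h M N _ e hL => h (e.symm.unop ≪≫ (opBiprodIso M.unop N.unop).unop) hL⟩

theorem IsWeaklyCoresolving.op (h : IsWeaklyCoresolving P X) : IsWeaklyResolving P.op X.op where
  additive := h.additive.op
  le M := h.le M.unop
  precover M hM := (hasPrecover_op_iff M).2 (h.preenvelope _ hM)
  kernel_mem _ _ f hM hN hf := h.additive.of_iso (kernelOpUnop f.unop).symm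
    (h.cokernel_mem f.unop hN hM ((isRelEpi_op_iff f).1 hf))

theorem IsWeaklyCoresolving.of_op (h : IsWeaklyResolving P.op X.op) : IsWeaklyCoresolving P X where
  additive := .of_op h.additive
  le M := h.le (Opposite.op M)
  preenvelope M hM := (hasPrecover_op_iff (Opposite.op M)).1 (h.precover (Opposite.op M) hM)
  cokernel_mem _ _ f hM hN hf := (IsAdditiveSubcategory.of_op h.additive).of_iso (kernelOpUnop f)
    (h.kernel_mem f.op hN hM ((isRelEpi_op_iff f.op).2 hf))

end

end Opposite

/-! ### Coreflections, by passage to the opposite category -/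

section Coreflections

variable {A : Type u} [Category.{v} A] [Abelian A] {P X : ObjectProperty A}

theorem IsWeaklyCoresolving.closedUnderStableIso (hX : IsWeaklyCoresolving P X)
    (hsum : ClosedUnderSummands X) : ClosedUnderStableIso P X :=
  closedUnderStableIso_of_op (hX.op.closedUnderStableIso (closedUnderSummands_op_iff.2 hsum))

theorem IsWeaklyCoresolving.cokernel_preenvelope_mem (hX : IsWeaklyCoresolving P X) {M E : A}
    (hM : X M) {p : M ⟶ E} (hp : IsPreenvelope P p) : X (cokernel p) :=
  hX.cokernel_mem p hM (hX.le _ hp.mem) hp.relMono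

variable [hP : IsAdditiveSubcategory P]

theorem IsWeaklyCoresolving.exists_stableCoreflection (hpre : IsPrecovering P)
    (hidem : StableIdempotentsSplit P) (hX : IsWeaklyCoresolving P X) (hXpre : IsPrecovering X)
    (hsum : ClosedUnderSummands X) (M : A) :
    ∃ (R : A) (f : R ⟶ M), IsStableCoreflection P X f :=
  haveI := hP.op
  (exists_stableReflection_op_iff (Opposite.op M)).1
    (hX.op.exists_stableReflection (isPreenveloping_op_iff.2 hpre) hidem.op
      (isPreenveloping_op_iff.2 hXpre) (closedUnderSummands_op_iff.2 hsum) (Opposite.op M))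

variable (hX : ClosedUnderStableIso P X)
  (hcorefl : ∀ M : A, ∃ (R : A) (f : R ⟶ M), IsStableCoreflection P X f)
include hX hcorefl

omit hP in
theorem summand_mem_of_exists_stableCoreflection : ClosedUnderSummands X :=
  closedUnderSummands_op_iff.1 (summand_mem_of_exists_stableReflection
    (closedUnderStableIso_op hX) fun M => (exists_stableReflection_op_iff M).2 (hcorefl M.unop))

theorem isPrecovering_of_exists_stableCoreflection (hpre : IsPrecovering P) : IsPrecovering X :=
  haveI := hP.op
  isPreenveloping_op_iff.1 (isPreenveloping_of_exists_stableReflection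
    (closedUnderStableIso_op hX) (fun M => (exists_stableReflection_op_iff M).2 (hcorefl M.unop))
    (isPreenveloping_op_iff.2 hpre))

theorem isWeaklyCoresolving_of_exists_stableCoreflection (henv : IsPreenveloping P)
    (hcoker : ∀ M : A, X M → ∃ (E : A) (p : M ⟶ E), IsPreenvelope P p ∧ X (cokernel p)) :
    IsWeaklyCoresolving P X := by
  have := hP.op
  have hX' := closedUnderStableIso_op hX
  have hrefl := fun M => (exists_stableReflection_op_iff M).2 (hcorefl M.unop)
  refine .of_op (isWeaklyResolving_of_exists_stableReflection (isPrecovering_op_iff.2 henv)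
    hX' hrefl fun M hM => ?_)
  obtain ⟨E, p, hp, hp'⟩ := hcoker M.unop hM
  exact ⟨Opposite.op E, p.op, ⟨hp.mem, (isRelEpi_op_iff p.op).2 hp.relMono⟩,
    (isAdditiveSubcategory_of_exists_stableReflection hX' hrefl).of_iso (kernelOpOp p).symm hp'⟩

end Coreflections

/-! ### Adjoints of full inclusions as universal morphisms -/

section Adjoints

variable {C : Type u} [Category.{v} C] (Z : ObjectProperty C)

/-- The inclusion of a full subcategory has a left adjoint if and only if every object has a
universal morphism to the subcategory. -/
theorem ι_isRightAdjoint_iff : Z.ι.IsRightAdjoint ↔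
    ∀ M : C, ∃ (R : C) (f : M ⟶ R), Z R ∧ ∀ ⦃N : C⦄, Z N → ∀ a : M ⟶ N, ∃! b : R ⟶ N, f ≫ b = a := by
  rw [isRightAdjoint_iff_hasInitial_structuredArrow]
  refine forall_congr' fun M => ⟨fun h => ?_, ?_⟩
  · let I := ⊥_ (StructuredArrow M Z.ι)
    refine ⟨I.right.obj, I.hom, I.right.property, fun N hN a => ?_⟩
    let J : StructuredArrow M Z.ι :=
      StructuredArrow.mk (T := Z.ι) (Y := (⟨N, hN⟩ : Z.FullSubcategory)) a
    refine ⟨(initial.to J).right.hom, StructuredArrow.w (initial.to J), fun b hb => ?_⟩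
    have : StructuredArrow.homMk (f := I) (f' := J) (ObjectProperty.homMk b) hb = initial.to J :=
      Subsingleton.elim _ _
    exact congrArg (fun t => t.right.hom) this
  · rintro ⟨R, f, hR, hf⟩
    let I : StructuredArrow M Z.ι :=
      StructuredArrow.mk (T := Z.ι) (Y := (⟨R, hR⟩ : Z.FullSubcategory)) f
    have hI : IsInitial I := IsInitial.ofUniqueHom
      (fun J => StructuredArrow.homMk (ObjectProperty.homMk (hf J.right.property J.hom).choose)
        (hf J.right.property J.hom).choose_spec.1)
      (fun J m => StructuredArrow.ext _ _ (ObjectProperty.hom_ext _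
        ((hf J.right.property J.hom).choose_spec.2 m.right.hom (StructuredArrow.w m))))
    exact hI.hasInitial

/-- The inclusion of a full subcategory has a right adjoint if and only if every object has a
universal morphism from the subcategory. -/
theorem ι_isLeftAdjoint_iff : Z.ι.IsLeftAdjoint ↔
    ∀ M : C, ∃ (R : C) (f : R ⟶ M), Z R ∧ ∀ ⦃N : C⦄, Z N → ∀ a : N ⟶ M, ∃! b : N ⟶ R, b ≫ f = a := by
  rw [isLeftAdjoint_iff_hasTerminal_costructuredArrow]
  refine forall_congr' fun M => ⟨fun h => ?_, ?_⟩
  · let I := ⊤_ (CostructuredArrow Z.ι M)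
    refine ⟨I.left.obj, I.hom, I.left.property, fun N hN a => ?_⟩
    let J : CostructuredArrow Z.ι M :=
      CostructuredArrow.mk (S := Z.ι) (Y := (⟨N, hN⟩ : Z.FullSubcategory)) a
    refine ⟨(terminal.from J).left.hom, CostructuredArrow.w (terminal.from J), fun b hb => ?_⟩
    have : CostructuredArrow.homMk (f := J) (f' := I) (ObjectProperty.homMk b) hb =
      terminal.from J := Subsingleton.elim _ _
    exact congrArg (fun t => t.left.hom) this
  · rintro ⟨R, f, hR, hf⟩
    let I : CostructuredArrow Z.ι M :=
      CostructuredArrow.mk (S := Z.ι) (Y := (⟨R, hR⟩ : Z.FullSubcategory)) f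
    have hI : IsTerminal I := IsTerminal.ofUniqueHom
      (fun J => CostructuredArrow.homMk (ObjectProperty.homMk (hf J.left.property J.hom).choose)
        (hf J.left.property J.hom).choose_spec.1)
      (fun J m => CostructuredArrow.ext _ _ (ObjectProperty.hom_ext _
        ((hf J.left.property J.hom).choose_spec.2 m.left.hom (CostructuredArrow.w m))))
    exact hI.hasTerminal

end Adjoints

/-! ### Translation between A/P and representatives in A -/

section StableImage

variable {A : Type u} [Category.{v} A] [Preadditive A] {P X : ObjectProperty A}

theorem stableImage_iff (M : Stable P) : stableImage P X M ↔ X M.as :=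
  ⟨fun ⟨_, h⟩ => h, fun h => ⟨M.as, h⟩⟩

/-- A/P has the same objects as A, so no closure property of the subcategories is needed. -/
theorem stableImage_injective :
    Function.Injective (fun X : ObjectProperty A => stableImage P X) := fun X Y h => by
  funext M
  have := congrFun h ((toStable P).obj M)
  dsimp only at this
  rwa [propext (stableImage_iff _), propext (stableImage_iff _)] at this

theorem stableImage_inverseImage (Z : ObjectProperty (Stable P)) :
    stableImage P (Z.inverseImage (toStable P)) = Z := by
  funext M
  exact propext (stableImage_iff M)

variable [HasZeroObject A] [HasBinaryBiproducts A] [IsAdditiveSubcategory P]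

theorem closedUnderStableIso_iff :
    ClosedUnderStableIso P X ↔ (stableImage P X).IsClosedUnderIsomorphisms := by
  constructor
  · refine fun h => ⟨fun {M N} e hM => ?_⟩
    obtain ⟨f, hf⟩ := (toStable P).map_surjective (X := M.as) (Y := N.as) e.hom
    obtain ⟨g, hg⟩ := (toStable P).map_surjective (X := N.as) (Y := M.as) e.inv
    rw [stableImage_iff] at hM ⊢
    refine h f g ?_ ?_ hM
    · rw [factorsThru_sub_iff, Functor.map_comp, hf, hg]
      exact e.hom_inv_id
    · rw [factorsThru_sub_iff, Functor.map_comp, hf, hg]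
      exact e.inv_hom_id
  · intro h M N f g hfg hgf hM
    rw [factorsThru_sub_iff, Functor.map_comp, CategoryTheory.Functor.map_id] at hfg hgf
    exact (stableImage_iff _).1 (h.of_iso
      (⟨(toStable P).map f, (toStable P).map g, hfg, hgf⟩ :
        (toStable P).obj M ≅ (toStable P).obj N) ((stableImage_iff _).2 hM))

/-- Fullness of `toStable P` provides representatives, and additivity turns uniqueness of
factorizations into a statement about differences that are stably zero. -/
theorem isReflectiveSubcategory_iff :
    IsReflectiveSubcategory (stableImage P X) ↔ ClosedUnderStableIso P X ∧
      ∀ M : A, ∃ (R : A) (f : M ⟶ R), IsStableReflection P X f := by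
  have key : (stableImage P X).ι.IsRightAdjoint ↔
      ∀ M : A, ∃ (R : A) (f : M ⟶ R), IsStableReflection P X f := by
    rw [ι_isRightAdjoint_iff]
    constructor
    · intro h M
      obtain ⟨R, f, hR, hf⟩ := h ((toStable P).obj M)
      obtain ⟨f, rfl⟩ := (toStable P).map_surjective (Y := R.as) f
      refine ⟨R.as, f, (stableImage_iff _).1 hR, fun N hN a => ?_, fun N hN g hg => ?_⟩
      · obtain ⟨b, hb, -⟩ := hf (N := (toStable P).obj N) ⟨N, hN⟩ ((toStable P).map a)
        obtain ⟨b, rfl⟩ := (toStable P).map_surjective (X := R.as) b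
        refine ⟨b, ?_⟩
        rw [factorsThru_sub_iff, Functor.map_comp]
        exact hb
      · rw [factorsThru_iff_map_eq_zero, Functor.map_comp] at hg
        rw [factorsThru_iff_map_eq_zero]
        exact (hf (N := (toStable P).obj N) ⟨N, hN⟩ 0).unique hg comp_zero
    · intro h M
      obtain ⟨R, f, hf⟩ := h M.as
      refine ⟨(toStable P).obj R, (toStable P).map f, ⟨R, hf.mem⟩, fun N hN a => ?_⟩
      rw [stableImage_iff] at hN
      obtain ⟨a, rfl⟩ := (toStable P).map_surjective (X := M.as) (Y := N.as) a
      obtain ⟨b, hb⟩ := hf.exists_fac hN a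
      rw [factorsThru_sub_iff, Functor.map_comp] at hb
      refine ⟨(toStable P).map b, hb, fun b' hb' => ?_⟩
      obtain ⟨b', rfl⟩ := (toStable P).map_surjective (Y := N.as) b'
      rw [← factorsThru_sub_iff]
      refine hf.unique hN _ ?_
      rw [Preadditive.comp_sub, factorsThru_sub_iff, Functor.map_comp, Functor.map_comp]
      exact hb'.trans hb.symm
  rw [closedUnderStableIso_iff, ← key]
  exact ⟨fun h => ⟨h.1, h.2⟩, fun h => ⟨h.1, h.2⟩⟩

theorem isCoreflectiveSubcategory_iff :
    IsCoreflectiveSubcategory (stableImage P X) ↔ ClosedUnderStableIso P X ∧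
      ∀ M : A, ∃ (R : A) (f : R ⟶ M), IsStableCoreflection P X f := by
  have key : (stableImage P X).ι.IsLeftAdjoint ↔
      ∀ M : A, ∃ (R : A) (f : R ⟶ M), IsStableCoreflection P X f := by
    rw [ι_isLeftAdjoint_iff]
    constructor
    · intro h M
      obtain ⟨R, f, hR, hf⟩ := h ((toStable P).obj M)
      obtain ⟨f, rfl⟩ := (toStable P).map_surjective (X := R.as) f
      refine ⟨R.as, f, (stableImage_iff _).1 hR, fun N hN a => ?_, fun N hN g hg => ?_⟩
      · obtain ⟨b, hb, -⟩ := hf (N := (toStable P).obj N) ⟨N, hN⟩ ((toStable P).map a)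
        obtain ⟨b, rfl⟩ := (toStable P).map_surjective (Y := R.as) b
        refine ⟨b, ?_⟩
        rw [factorsThru_sub_iff, Functor.map_comp]
        exact hb
      · rw [factorsThru_iff_map_eq_zero, Functor.map_comp] at hg
        rw [factorsThru_iff_map_eq_zero]
        exact (hf (N := (toStable P).obj N) ⟨N, hN⟩ 0).unique hg zero_comp
    · intro h M
      obtain ⟨R, f, hf⟩ := h M.as
      refine ⟨(toStable P).obj R, (toStable P).map f, ⟨R, hf.mem⟩, fun N hN a => ?_⟩
      rw [stableImage_iff] at hN
      obtain ⟨a, rfl⟩ := (toStable P).map_surjective (X := N.as) (Y := M.as) a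
      obtain ⟨b, hb⟩ := hf.exists_fac hN a
      rw [factorsThru_sub_iff, Functor.map_comp] at hb
      refine ⟨(toStable P).map b, hb, fun b' hb' => ?_⟩
      obtain ⟨b', rfl⟩ := (toStable P).map_surjective (X := N.as) b'
      rw [← factorsThru_sub_iff]
      refine hf.unique hN _ ?_
      rw [Preadditive.sub_comp, factorsThru_sub_iff, Functor.map_comp, Functor.map_comp]
      exact hb'.trans hb.symm
  rw [closedUnderStableIso_iff, ← key]
  exact ⟨fun h => ⟨h.1, h.2⟩, fun h => ⟨h.1, h.2⟩⟩

theorem stableIdempotentsSplit_of_isIdempotentComplete [IsIdempotentComplete (Stable P)] :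
    StableIdempotentsSplit P := by
  intro M e he
  rw [factorsThru_sub_iff, Functor.map_comp] at he
  obtain ⟨N, i, r, hir, hri⟩ := IsIdempotentComplete.idempotents_split _ _ he
  obtain ⟨i, rfl⟩ := (toStable P).map_surjective (X := N.as) i
  obtain ⟨r, rfl⟩ := (toStable P).map_surjective (Y := N.as) r
  refine ⟨N.as, i, r, ?_, ?_⟩
  · rw [factorsThru_sub_iff, Functor.map_comp]
    exact hir
  · rw [factorsThru_sub_iff, Functor.map_comp]
    exact hri

end StableImage

/-! ### The two bijections -/

section Bijections

variable {A : Type u} [Category.{v} A] [Abelian A] (P : ObjectProperty A)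
  [IsAdditiveSubcategory P] (hpre : IsPrecovering P) (henv : IsPreenveloping P)
  [IsIdempotentComplete (Stable P)]
include hpre henv

theorem bijOn_preenveloping_weaklyResolving :
    Set.BijOn (fun X : ObjectProperty A => stableImage P X)
      {X | IsPreenveloping X ∧ IsWeaklyResolving P X ∧ ClosedUnderSummands X}
      {Z | IsReflectiveSubcategory Z ∧ ∀ M, Z M → Z ((loop hpre).obj M)} := by
  refine ⟨?_, stableImage_injective.injOn, ?_⟩
  · rintro X ⟨hXenv, hX, hsum⟩
    refine ⟨isReflectiveSubcategory_iff.2 ⟨hX.closedUnderStableIso hsum,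
      hX.exists_stableReflection henv stableIdempotentsSplit_of_isIdempotentComplete hXenv hsum⟩, ?_⟩
    rintro _ ⟨M, hM⟩
    exact (stableImage_iff _).2 (hX.kernel_precover_mem hM (precoverMap_spec hpre M))
  · rintro Z ⟨hZ, hΩ⟩
    refine ⟨Z.inverseImage (toStable P), ?_, stableImage_inverseImage Z⟩
    -- Writing Z as the image of its preimage makes the criterion in terms of representatives
    -- available.
    rw [← stableImage_inverseImage Z, isReflectiveSubcategory_iff] at hZ
    obtain ⟨hX, hrefl⟩ := hZ
    exact ⟨isPreenveloping_of_exists_stableReflection hX hrefl henv,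
      isWeaklyResolving_of_exists_stableReflection hpre hX hrefl
        -- On objects `loop` is by definition the kernel of the chosen precover, so stability under
        -- Ω is literally the required membership.
        fun M hM => ⟨_, _, precoverMap_spec hpre M, hΩ _ hM⟩,
      summand_mem_of_exists_stableReflection hX hrefl⟩

theorem bijOn_precovering_weaklyCoresolving :
    Set.BijOn (fun X : ObjectProperty A => stableImage P X)
      {X | IsPrecovering X ∧ IsWeaklyCoresolving P X ∧ ClosedUnderSummands X}
      {Z | IsCoreflectiveSubcategory Z ∧ ∀ M, Z M → Z ((suspension henv).obj M)} := by
  refine ⟨?_, stableImage_injective.injOn, ?_⟩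
  · rintro X ⟨hXpre, hX, hsum⟩
    refine ⟨isCoreflectiveSubcategory_iff.2 ⟨hX.closedUnderStableIso hsum,
      hX.exists_stableCoreflection hpre stableIdempotentsSplit_of_isIdempotentComplete hXpre hsum⟩,
      ?_⟩
    rintro _ ⟨M, hM⟩
    exact (stableImage_iff _).2 (hX.cokernel_preenvelope_mem hM (preenvelopeMap_spec henv M))
  · rintro Z ⟨hZ, hcoker⟩
    refine ⟨Z.inverseImage (toStable P), ?_, stableImage_inverseImage Z⟩
    rw [← stableImage_inverseImage Z, isCoreflectiveSubcategory_iff] at hZ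
    obtain ⟨hX, hcorefl⟩ := hZ
    exact ⟨isPrecovering_of_exists_stableCoreflection hX hcorefl hpre,
      isWeaklyCoresolving_of_exists_stableCoreflection hX hcorefl henv
        fun M hM => ⟨_, _, preenvelopeMap_spec henv M, hcoker _ hM⟩,
      summand_mem_of_exists_stableCoreflection hX hcorefl⟩

end Bijections

end StableReflective

theorem mainTheorem4 {A : Type u} [Category.{v} A] [Abelian A]
    (P : ObjectProperty A) [StableReflective.IsAdditiveSubcategory P]
    (hpre : StableReflective.IsPrecovering P) (henv : StableReflective.IsPreenveloping P)
    [IsIdempotentComplete (StableReflective.Stable P)] :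
    Set.BijOn (fun X : ObjectProperty A => StableReflective.stableImage P X)
      {X | StableReflective.IsPreenveloping X ∧ StableReflective.IsWeaklyResolving P X ∧
        StableReflective.ClosedUnderSummands X}
      {Z | StableReflective.IsReflectiveSubcategory Z ∧
        ∀ M, Z M → Z ((StableReflective.loop hpre).obj M)} ∧
    Set.BijOn (fun X : ObjectProperty A => StableReflective.stableImage P X)
      {X | StableReflective.IsPrecovering X ∧ StableReflective.IsWeaklyCoresolving P X ∧
        StableReflective.ClosedUnderSummands X}
      {Z | StableReflective.IsCoreflectiveSubcategory Z ∧
        ∀ M, Z M → Z ((StableReflective.suspension henv).obj M)} :=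
  ⟨StableReflective.bijOn_preenveloping_weaklyResolving P hpre henv,
    StableReflective.bijOn_precovering_weaklyCoresolving P hpre henv⟩
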